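/- Let $\mathfrak H=\mathbb Q\langle x,y\rangle$ be the non-commutative polynomial algebra in $x,y$, put $z=x+y$ and $z_k=x^{k-1}y$ for $k\ge 1$, and let $\mathfrak H^1=\mathbb Q+\mathfrak Hy\supset\mathfrak H^0=\mathbb Q+x\mathfrak Hy$. Let $\check{\mathfrak H}^1$ be the $\mathbb Q$-span of the words in $\mathfrak H^1$ other than the powers $y^m$ ($m\ge 0$). For $k_1\ge 2$, $k_2,\dots,k_l\ge1$ let $$\zeta(k_1,\dots,k_l)=\sum_{m_1>\cdots>m_l>0}\frac1{m_1^{k_1}\cdots m_l^{k_l}},$$ and let $Z\colon\mathfrak H^0\to\mathbb R$ be the $\mathbb Q$-linear map with $Z(1)=1$ and $Z(z_{k_1}\cdots z_{k_l})=\zeta(k_1,\dots,k_l)$. For $n\ge1$ make $\mathfrak H^{\otimes(n+1)}$ an $\mathfrak H$-bimodule by $$a\diamond(w_1\otimes\cdots\otimes w_{n+1})=w_1\otimes\cdots\otimes w_n\otimes aw_{n+1},\qquad (w_1\otimes\cdots\otimes w_{n+1})\diamond b=w_1b\otimes w_2\otimes\cdots\otimes w_{n+1}.$$ Let $\mathcal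 C_n\colon\mathfrak H\to\mathfrak H^{\otimes(n+1)}$ be the unique $\mathbb Q$-linear map with $\mathcal C_n(x)=x\otimes z^{\otimes(n-1)}\otimes y=-\mathcal C_n(y)$ and $\mathcal C_n(ww')=\mathcal C_n(w)\diamond w'+w\diamond\mathcal C_n(w')$ for all $w,w'\in\mathfrak H$. Let $M_n(w_1\otimes\cdots\otimes w_{n+1})=w_1\cdots w_{n+1}$ be the multiplication map, and let $\rho_n=M_n\mathcal C_n\colon\mathfrak H\to\mathfrak H$. **Theorem.** (1) For every $n\ge1$, $\rho_n(\check{\mathfrak H}^1)\subset\ker Z$; in particular $\rho_n(\check{\mathfrak H}^1)\subset\mathfrak H^0$. (2) For $n=1$ this is the Hoffman–Ohno cyclic sum formula: for all $l\ge 0$ and $k_1,\dots,k_l\ge1$, $$\rho_1(z_{k_1}\cdots z_{k_l})=\sum_{j=1}^l\sum_{i=1}^{k_j-1}z_{k_j-i+1}z_{k_{j+1}}\cdots z_{k_l}z_{k_1}\cdots z_{k_{j-1}}z_i-\sum_{j=1}^lz_{k_j+1}z_{k_{j+1}}\cdots z_{k_l}z_{k_1}\cdots z_{k_{j-1}},$$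 and, if some $k_q>1$, $$\sum_{j=1}^l\sum_{i=1}^{k_j-1}\zeta(k_j-i+1,k_{j+1},\dots,k_l,k_1,\dots,k_{j-1},i)=\sum_{j=1}^l\zeta(k_j+1,k_{j+1},\dots,k_l,k_1,\dots,k_{j-1}).$$ -/

import Mathlib

open scoped TensorProduct

namespace CyclicSum

/-- The two letters. -/
inductive Letter : Type
  | x : Letter
  | y : Letter

/-- The non-commutative polynomial algebra `ℚ⟨x, y⟩`. -/
abbrev H : Type := FreeAlgebra ℚ Letter

/-- The indeterminate `x`. -/
noncomputable def X : H := FreeAlgebra.ι ℚ Letter.x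

/-- The indeterminate `y`. -/
noncomputable def Y : H := FreeAlgebra.ι ℚ Letter.y

/-- The element of `H` given by a word (a finite sequence of letters). -/
noncomputable def word (w : List Letter) : H := (w.map (FreeAlgebra.ι ℚ)).prod

/-- `z_k = x ^ (k - 1) y`, used for `k ≥ 1`. -/
noncomputable def zgen (k : ℕ) : H := X ^ (k - 1) * Y

/-- `z_{k_1} ⋯ z_{k_l}`. -/
noncomputable def zword (k : List ℕ) : H := (k.map zgen).prod

/-- `H¹ = ℚ + H y`. -/
noncomputable def H1 : Subalgebra ℚ H where
  carrier := {a | ∃ (c : ℚ) (w : H), a = algebraMap ℚ H c + w * Y}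
  mul_mem' := by
    rintro _ _ ⟨c, w, rfl⟩ ⟨c', w', rfl⟩
    refine ⟨c * c', algebraMap ℚ H c' * w + algebraMap ℚ H c * w' + w * Y * w', ?_⟩
    have h : w * Y * algebraMap ℚ H c' = algebraMap ℚ H c' * (w * Y) :=
      (Algebra.commutes c' (w * Y)).symm
    rw [map_mul, add_mul, mul_add, mul_add, h]
    noncomm_ring
  add_mem' := by
    rintro _ _ ⟨c, w, rfl⟩ ⟨c', w', rfl⟩
    exact ⟨c + c', w + w', by rw [map_add, add_mul]; abel⟩
  algebraMap_mem' c := ⟨c, 0, by simp⟩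

/-- `H⁰ = ℚ + x H y`. -/
noncomputable def H0 : Subalgebra ℚ H where
  carrier := {a | ∃ (c : ℚ) (w : H), a = algebraMap ℚ H c + X * w * Y}
  mul_mem' := by
    rintro _ _ ⟨c, w, rfl⟩ ⟨c', w', rfl⟩
    refine ⟨c * c', algebraMap ℚ H c' * w + algebraMap ℚ H c * w' + w * Y * X * w', ?_⟩
    have h : X * w * Y * algebraMap ℚ H c' = X * (algebraMap ℚ H c' * w) * Y := by
      rw [Algebra.commutes c' w, mul_assoc (X * w), ← Algebra.commutes c' Y]
      noncomm_ring
    have h' : algebraMap ℚ H c * (X * w' * Y) = X * (algebraMap ℚ H c * w') * Y := by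
      rw [← mul_assoc, ← mul_assoc, Algebra.commutes c X]
      noncomm_ring
    rw [map_mul, add_mul, mul_add, mul_add, h, h']
    noncomm_ring
  add_mem' := by
    rintro _ _ ⟨c, w, rfl⟩ ⟨c', w', rfl⟩
    exact ⟨c + c', w + w', by rw [map_add, mul_add, add_mul]; abel⟩
  algebraMap_mem' c := ⟨c, 0, by simp⟩

/-- The `ℚ`-span of the words lying in `H¹` which are not a power of `y`. -/
noncomputable def H1check : Submodule ℚ H :=
  Submodule.span ℚ {u : H | (∃ w : List Letter, u = word w) ∧ u ∈ H1 ∧ ∀ m : ℕ, u ≠ Y ^ m}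

/-! ### Multiple zeta values -/

/-- `ζ(k_1, …, k_n) = ∑_{m_1 > ⋯ > m_n > 0} 1 / (m_1 ^ k_1 ⋯ m_n ^ k_n)`; it is `1` for the empty
index, and only meaningful if the index is empty or `k_1 > 1` and all `k_i ≥ 1`. -/
noncomputable def mzv (k : List ℕ) : ℝ :=
  ∑' m : {m : Fin k.length → ℕ // StrictAnti m ∧ ∀ i, 0 < m i},
    ∏ i : Fin k.length, 1 / ((m.1 i : ℝ) ^ k.get i)

/-- Reads off the index `(k_1, …, k_n)` of a word: `readIndex q w` is the index of `x ^ q w`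
(a final block of `x`s, which no word of `H¹` has, is discarded). -/
def readIndex : ℕ → List Letter → List ℕ
  | _, [] => []
  | q, Letter.x :: w => readIndex (q + 1) w
  | q, Letter.y :: w => (q + 1) :: readIndex 0 w

/-- The linear map on `H` sending each word to the multiple zeta value of its index. Only its
restriction to `H⁰` is meaningful. -/
noncomputable def ZAux : H →ₗ[ℚ] ℝ :=
  (FreeAlgebra.basisFreeMonoid ℚ Letter).constr ℚ
    fun w : FreeMonoid Letter => mzv (readIndex 0 (FreeMonoid.toList w))

/-- The evaluation map `Z : H⁰ → ℝ`. -/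
noncomputable def Z : H0 →ₗ[ℚ] ℝ := ZAux ∘ₗ H0.val.toLinearMap

theorem basis_eq_word (w : List Letter) :
    FreeAlgebra.basisFreeMonoid ℚ Letter (FreeMonoid.ofList w) = word w := by
  have h : FreeAlgebra.basisFreeMonoid ℚ Letter (FreeMonoid.ofList w) =
      FreeAlgebra.equivMonoidAlgebraFreeMonoid.symm
        (MonoidAlgebra.of ℚ (FreeMonoid Letter) (FreeMonoid.ofList w)) := rfl
  rw [h, AlgEquiv.symm_apply_eq, word, map_list_prod, List.map_map]
  clear h
  induction w with
  | nil => rfl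
  | cons a w ih =>
    rw [FreeMonoid.ofList_cons, map_mul, ih, List.map_cons, List.prod_cons]
    congr 1
    simp [FreeAlgebra.equivMonoidAlgebraFreeMonoid]

theorem ZAux_word (w : List Letter) : ZAux (word w) = mzv (readIndex 0 w) := by
  rw [← basis_eq_word, ZAux, Module.Basis.constr_basis, FreeMonoid.toList_ofList]

theorem mzv_nil : mzv [] = 1 := by
  have : Unique {m : Fin ([] : List ℕ).length → ℕ // StrictAnti m ∧ ∀ i, 0 < m i} :=
    { default := ⟨fun _ => 0, fun i => i.elim0, fun i => i.elim0⟩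
      uniq := fun m => Subtype.ext (funext fun i => i.elim0) }
  rw [mzv, tsum_fintype]
  simp

/-- `Z(1) = 1`. -/
theorem Z_one : Z 1 = 1 := by
  have h : (1 : H) = word [] := rfl
  change ZAux 1 = 1
  rw [h, ZAux_word, readIndex, mzv_nil]

theorem zword_eq_word (k : List ℕ) :
    zword k = word (k.flatMap fun a => List.replicate (a - 1) Letter.x ++ [Letter.y]) := by
  induction k with
  | nil => rfl
  | cons a k ih =>
    have hw : ∀ u v, word (u ++ v) = word u * word v := fun u v => by simp [word]
    rw [List.flatMap_cons, hw, hw, ← ih]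
    simp [zword, zgen, word, X, Y]

theorem readIndex_replicate (q r : ℕ) (w : List Letter) :
    readIndex q (List.replicate r Letter.x ++ w) = readIndex (q + r) w := by
  induction r generalizing q with
  | zero => rfl
  | succ r ih =>
    rw [List.replicate_succ, List.cons_append, readIndex, ih]
    congr 1
    omega

/-- `Z(x ^ (k_1 - 1) y ⋯ x ^ (k_n - 1) y) = ζ(k_1, …, k_n)`. -/
theorem Z_zword (k : List ℕ) (hk : ∀ a ∈ k, 1 ≤ a) (h : zword k ∈ H0) :
    Z ⟨zword k, h⟩ = mzv k := by
  change ZAux (zword k) = mzv k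
  rw [zword_eq_word, ZAux_word]
  congr 1
  clear h
  induction k with
  | nil => rfl
  | cons a k ih =>
    have ha : 1 ≤ a := hk a (by simp)
    rw [List.flatMap_cons, List.append_assoc, readIndex_replicate, List.singleton_append,
      readIndex, ih fun b hb => hk b (by simp [hb])]
    congr 1
    omega

/-! ### The bimodule `H^{⊗(n+1)}` and the map `𝒞_n` -/

/-- `H^{⊗(n+1)}`, with factors numbered `0, …, n`; below it carries the bimodule structure `⋄`. -/
def Tens (n : ℕ) : Type := ⨂[ℚ] _ : Fin (n + 1), H

noncomputable instance (n : ℕ) : AddCommGroup (Tens n) :=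
  inferInstanceAs (AddCommGroup (⨂[ℚ] _ : Fin (n + 1), H))

noncomputable instance (n : ℕ) : Module ℚ (Tens n) :=
  inferInstanceAs (Module ℚ (⨂[ℚ] _ : Fin (n + 1), H))

/-- The pure tensor `w 0 ⊗ ⋯ ⊗ w n`. -/
noncomputable def tpure {n : ℕ} (w : Fin (n + 1) → H) : Tens n := PiTensorProduct.tprod ℚ w

/-- Apply a linear map to the `i`-th tensor factor. -/
noncomputable def onFactor {n : ℕ} (i : Fin (n + 1)) (f : H →ₗ[ℚ] H) : Tens n →ₗ[ℚ] Tens n :=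
  PiTensorProduct.map (Function.update (fun _ => LinearMap.id) i f)

theorem onFactor_tpure {n : ℕ} (i : Fin (n + 1)) (f : H →ₗ[ℚ] H) (w : Fin (n + 1) → H) :
    onFactor i f (tpure w) = tpure (Function.update w i (f (w i))) := by
  refine (PiTensorProduct.map_tprod _ w).trans ?_
  unfold tpure
  congr 1
  funext j
  by_cases h : j = i
  · subst h; simp
  · simp [h]

theorem tens_hom_ext {n : ℕ} {f g : Tens n →ₗ[ℚ] Tens n} (h : ∀ w, f (tpure w) = g (tpure w)) :
    f = g :=
  PiTensorProduct.ext (MultilinearMap.ext h)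

theorem onFactor_id {n : ℕ} (i : Fin (n + 1)) :
    onFactor (n := n) i LinearMap.id = LinearMap.id :=
  tens_hom_ext fun w => by simp [onFactor_tpure]

theorem onFactor_comp {n : ℕ} (i : Fin (n + 1)) (f g : H →ₗ[ℚ] H) :
    onFactor (n := n) i (f ∘ₗ g) = onFactor i f ∘ₗ onFactor i g :=
  tens_hom_ext fun w => by simp [onFactor_tpure]

theorem onFactor_add {n : ℕ} (i : Fin (n + 1)) (f g : H →ₗ[ℚ] H) :
    onFactor (n := n) i (f + g) = onFactor i f + onFactor i g :=
  tens_hom_ext fun w => by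
    rw [LinearMap.add_apply, onFactor_tpure, onFactor_tpure, onFactor_tpure, LinearMap.add_apply]
    exact (PiTensorProduct.tprod ℚ).map_update_add w i (f (w i)) (g (w i))

theorem onFactor_smul {n : ℕ} (i : Fin (n + 1)) (c : ℚ) (f : H →ₗ[ℚ] H) :
    onFactor (n := n) i (c • f) = c • onFactor i f :=
  tens_hom_ext fun w => by
    rw [LinearMap.smul_apply, onFactor_tpure, onFactor_tpure, LinearMap.smul_apply]
    exact (PiTensorProduct.tprod ℚ).map_update_smul w i c (f (w i))

/-- `a ⋄ (w_1 ⊗ ⋯ ⊗ w_{n+1}) = w_1 ⊗ ⋯ ⊗ w_n ⊗ a w_{n+1}`. -/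
noncomputable def leftDiamond {n : ℕ} (a : H) : Tens n →ₗ[ℚ] Tens n :=
  onFactor (Fin.last n) (LinearMap.mulLeft ℚ a)

/-- `(w_1 ⊗ ⋯ ⊗ w_{n+1}) ⋄ b = w_1 b ⊗ w_2 ⊗ ⋯ ⊗ w_{n+1}`. -/
noncomputable def rightDiamond {n : ℕ} (b : H) : Tens n →ₗ[ℚ] Tens n :=
  onFactor 0 (LinearMap.mulRight ℚ b)

/-- The left module structure `⋄`. -/
noncomputable instance (n : ℕ) : Module H (Tens n) where
  smul a t := leftDiamond a t
  one_smul t := by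
    change leftDiamond 1 t = t
    rw [leftDiamond, LinearMap.mulLeft_one, onFactor_id, LinearMap.id_apply]
  mul_smul a b t := by
    change leftDiamond (a * b) t = leftDiamond a (leftDiamond b t)
    rw [leftDiamond, LinearMap.mulLeft_mul, onFactor_comp, LinearMap.comp_apply]; rfl
  smul_zero a := map_zero (leftDiamond a)
  smul_add a := map_add (leftDiamond a)
  add_smul a b t := by
    change leftDiamond (a + b) t = leftDiamond a t + leftDiamond b t
    have h : LinearMap.mulLeft ℚ (a + b) = LinearMap.mulLeft ℚ a + LinearMap.mulLeft ℚ b := by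
      ext; simp [add_mul]
    rw [leftDiamond, h, onFactor_add]; rfl
  zero_smul t := by
    change leftDiamond 0 t = 0
    have h : LinearMap.mulLeft ℚ (0 : H) = (0 : ℚ) • LinearMap.id := by ext; simp
    rw [leftDiamond, h, onFactor_smul, zero_smul, LinearMap.zero_apply]

/-- The right module structure `⋄`. -/
noncomputable instance (n : ℕ) : Module Hᵐᵒᵖ (Tens n) where
  smul b t := rightDiamond b.unop t
  one_smul t := by
    change rightDiamond 1 t = t
    rw [rightDiamond, LinearMap.mulRight_one, onFactor_id, LinearMap.id_apply]
  mul_smul a b t := by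
    change rightDiamond (b.unop * a.unop) t = rightDiamond a.unop (rightDiamond b.unop t)
    rw [rightDiamond, LinearMap.mulRight_mul, onFactor_comp, LinearMap.comp_apply]; rfl
  smul_zero a := map_zero (rightDiamond a.unop)
  smul_add a := map_add (rightDiamond a.unop)
  add_smul a b t := by
    change rightDiamond (a.unop + b.unop) t = rightDiamond a.unop t + rightDiamond b.unop t
    have h : LinearMap.mulRight ℚ (a.unop + b.unop) =
        LinearMap.mulRight ℚ a.unop + LinearMap.mulRight ℚ b.unop := by
      ext; simp [mul_add]
    rw [rightDiamond, h, onFactor_add]; rfl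
  zero_smul t := by
    change rightDiamond 0 t = 0
    have h : LinearMap.mulRight ℚ (0 : H) = (0 : ℚ) • LinearMap.id := by ext; simp
    rw [rightDiamond, h, onFactor_smul, zero_smul, LinearMap.zero_apply]

theorem left_smul_def {n : ℕ} (a : H) (t : Tens n) : a • t = leftDiamond a t := rfl

theorem right_smul_def {n : ℕ} (b : H) (t : Tens n) :
    MulOpposite.op b • t = rightDiamond b t := rfl

/-- `a ⋄ (t ⋄ b) = (a ⋄ t) ⋄ b`. -/
instance (n : ℕ) : SMulCommClass H Hᵐᵒᵖ (Tens n) where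
  smul_comm a b t := by
    have h : leftDiamond a ∘ₗ rightDiamond b.unop =
        rightDiamond b.unop ∘ₗ leftDiamond (n := n) a := by
      refine tens_hom_ext fun w => ?_
      simp only [LinearMap.comp_apply, leftDiamond, rightDiamond, onFactor_tpure]
      congr 1
      by_cases h0 : (0 : Fin (n + 1)) = Fin.last n
      · rw [← h0]; simp [mul_assoc]
      · rw [Function.update_comm h0]
        simp [Function.update_of_ne h0, Function.update_of_ne (Ne.symm h0)]
    exact LinearMap.congr_fun h t

instance (n : ℕ) : IsScalarTower ℚ H (Tens n) where
  smul_assoc c a t := by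
    have h : LinearMap.mulLeft ℚ (c • a) = c • LinearMap.mulLeft ℚ a := by ext; simp
    rw [left_smul_def, leftDiamond, h, onFactor_smul]; rfl

instance (n : ℕ) : IsScalarTower ℚ Hᵐᵒᵖ (Tens n) where
  smul_assoc c b t := by
    have h : LinearMap.mulRight ℚ (c • b.unop) = c • LinearMap.mulRight ℚ b.unop := by
      ext; simp
    change rightDiamond (c • b.unop) t = c • rightDiamond b.unop t
    rw [rightDiamond, h, onFactor_smul]; rfl

/-- The tensor `x ⊗ z^{⊗(n-1)} ⊗ y` with `z = x + y`, for `n ≥ 1`. -/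
noncomputable def baseTensor (n : ℕ) : Tens n :=
  tpure fun i => if i = 0 then X else if i = Fin.last n then Y else X + Y

/-- The algebra morphism `w ↦ (w, 𝒞_n(w))` into the square-zero extension of `H` by the bimodule
`H^{⊗(n+1)}`. -/
noncomputable def CHom (n : ℕ) : H →ₐ[ℚ] TrivSqZeroExt H (Tens n) :=
  FreeAlgebra.lift ℚ fun
    | Letter.x => TrivSqZeroExt.inl X + TrivSqZeroExt.inr (baseTensor n)
    | Letter.y => TrivSqZeroExt.inl Y + TrivSqZeroExt.inr (-baseTensor n)

/-- The map `𝒞_n`: the derivation of `H` into the bimodule `H^{⊗(n+1)}` with the values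
`𝒞_n(x) = x ⊗ z^{⊗(n-1)} ⊗ y = -𝒞_n(y)`. -/
noncomputable def C (n : ℕ) : H →ₗ[ℚ] Tens n :=
  (TrivSqZeroExt.sndHom H (Tens n)).restrictScalars ℚ ∘ₗ (CHom n).toLinearMap

theorem fst_CHom (n : ℕ) (w : H) : (CHom n w).fst = w := by
  have h : (TrivSqZeroExt.fstHom ℚ H (Tens n)).comp (CHom n) = AlgHom.id ℚ H := by
    refine FreeAlgebra.hom_ext (funext fun l => ?_)
    cases l <;> simp [CHom, X, Y]
  exact DFunLike.congr_fun h w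

theorem C_X (n : ℕ) : C n X = baseTensor n := by
  change (CHom n X).snd = _
  simp [CHom, X]

theorem C_Y (n : ℕ) : C n Y = -baseTensor n := by
  change (CHom n Y).snd = _
  simp [CHom, Y]

/-- `𝒞_n(w w') = 𝒞_n(w) ⋄ w' + w ⋄ 𝒞_n(w')`. -/
theorem C_mul (n : ℕ) (w w' : H) :
    C n (w * w') = rightDiamond w' (C n w) + leftDiamond w (C n w') := by
  change (CHom n (w * w')).snd = _
  rw [map_mul, TrivSqZeroExt.snd_mul, fst_CHom, fst_CHom, add_comm]
  rfl

/-- The multiplication map `M_n(w_1 ⊗ ⋯ ⊗ w_{n+1}) = w_1 ⋯ w_{n+1}`. -/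
noncomputable def M (n : ℕ) : Tens n →ₗ[ℚ] H :=
  PiTensorProduct.lift (MultilinearMap.mkPiAlgebraFin ℚ (n + 1) H)

theorem M_tpure {n : ℕ} (w : Fin (n + 1) → H) : M n (tpure w) = (List.ofFn w).prod :=
  (PiTensorProduct.lift.tprod w).trans (MultilinearMap.mkPiAlgebraFin_apply w)

/-- `ρ_n = M_n 𝒞_n`. -/
noncomputable def rho (n : ℕ) : H →ₗ[ℚ] H := M n ∘ₗ C n

end CyclicSum

/-! Algebra. On a letter, `M n` applied to `p ⋄ C n (letter) ⋄ q` gives `± x q z^(n-1) p y`, which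
depends only on the product `q z^(n-1) p`. By the Leibniz rule the same dependence holds on every
argument. Hence `rho n a = rho 1 (a z^(n-1))`, because `C 1` kills `z`, and `rho 1 (a b) = rho 1 (b
a)`. Expanding `z^(n-1)` and rotating each resulting word so that it ends in `y` reduces the
inclusion to `rho 1 (z_{k_1} ⋯ z_{k_l})` with some `k_q > 1`. Its explicit value (`rho_one_zword`)
is a difference of two sums in `H0`, so the inclusion becomes the cyclic sum formula.

Analysis. Let `S(k)` be the series `cyclicSeries k`, with general term `n_1^(-k_1) ⋯ n_l^(-k_l) /
(n_1 - q)` over `n_1 > ⋯ > n_l > q ≥ 0`. Splitting off `q = 0` and applying partial fractions to `1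
/ (n_1^(k_1) (n_1 - q))` gives (`cyclicSeries_rotate`) `S(k_1,…,k_l) + ∑_{0<i<k_1} ζ(k_1-i+1,
k_2,…,k_l, i) = ζ(k_1+1, k_2,…,k_l) + S(k_2,…,k_l,k_1)`. Over all rotations the `S` terms on the two
sides have the same total, which cancels once it is finite; finiteness is where some `k_q > 1` is
needed. Working in `[0, ∞]` makes every interchange of sums free. -/

namespace CyclicSum

/-! ### The maps `ρ_n` in terms of `ρ_1` -/

/-- `a ↦ M_n(p ⋄ 𝒞_n(a) ⋄ q)`. -/
noncomputable def sandwich (n : ℕ) (p q : H) : H →ₗ[ℚ] H :=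
  M n ∘ₗ leftDiamond p ∘ₗ rightDiamond q ∘ₗ C n

theorem rho_eq_sandwich (n : ℕ) (a : H) : rho n a = sandwich n 1 1 a := by
  change M n (C n a) = M n ((1 : H) • (1 : Hᵐᵒᵖ) • C n a)
  rw [one_smul, one_smul]

/-- Carrying both `p` and `q` makes the Leibniz rule close up, so identities can be proved by
induction on the argument. -/
theorem sandwich_mul (n : ℕ) (p q a b : H) :
    sandwich n p q (a * b) = sandwich n p (b * q) a + sandwich n (p * a) q b := by
  change M n (p • MulOpposite.op q • C n (a * b)) = M n (p • MulOpposite.op (b * q) • C n a) +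
    M n ((p * a) • MulOpposite.op q • C n b)
  rw [C_mul, ← left_smul_def, ← right_smul_def, smul_add, smul_add, map_add, smul_smul,
    ← smul_comm a, smul_smul, MulOpposite.op_mul]

theorem M_sandwich_baseTensor (m : ℕ) (p q : H) :
    M (m + 1) (leftDiamond p (rightDiamond q (baseTensor (m + 1)))) =
      X * q * (X + Y) ^ m * p * Y := by
  have h : leftDiamond p (rightDiamond q (baseTensor (m + 1))) =
      tpure (Fin.cons (X * q) (Fin.snoc (α := fun _ => H) (fun _ : Fin m => X + Y) (p * Y))) := by
    rw [baseTensor, rightDiamond, leftDiamond, onFactor_tpure, onFactor_tpure]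
    congr 1
    funext i
    refine Fin.cases ?_ (fun i => ?_) i
    · simp [Function.update, Fin.ext_iff]
    · refine Fin.lastCases ?_ (fun i => ?_) i
      · simp [Function.update, Fin.ext_iff]
      · have := i.2.ne
        simp [Function.update, Fin.ext_iff, this]
  rw [h, M_tpure, List.ofFn_cons, List.prod_cons, List.ofFn_succ', List.concat_eq_append,
    List.prod_append]
  simp [mul_assoc]

theorem sandwich_X (m : ℕ) (p q : H) :
    sandwich (m + 1) p q X = X * q * (X + Y) ^ m * p * Y := by
  rw [← M_sandwich_baseTensor]
  simp only [sandwich, LinearMap.comp_apply, C_X]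

theorem sandwich_Y (m : ℕ) (p q : H) :
    sandwich (m + 1) p q Y = -(X * q * (X + Y) ^ m * p * Y) := by
  rw [← M_sandwich_baseTensor]
  simp only [sandwich, LinearMap.comp_apply, C_Y, map_neg]

theorem sandwich_one (n : ℕ) (p q : H) : sandwich n p q 1 = 0 := by
  have h : C n 1 = 0 := by
    change (CHom n 1).snd = 0
    rw [map_one, TrivSqZeroExt.snd_one]
  simp only [sandwich, LinearMap.comp_apply, h, map_zero]

/-- Both sides obey the same product rule and agree on letters, where only `q z^m p` matters. The
next lemma rests on the same principle. -/
theorem sandwich_succ (m : ℕ) (a : H) : ∀ p q : H,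
    sandwich (m + 1) p q a = sandwich 1 p (q * (X + Y) ^ m) a := by
  induction a using FreeAlgebra.induction with
  | grade0 r => intro p q; rw [Algebra.algebraMap_eq_smul_one]; simp [sandwich_one]
  | grade1 l =>
    intro p q
    cases l
    · change sandwich (m + 1) p q X = sandwich (0 + 1) p _ X
      rw [sandwich_X, sandwich_X, pow_zero, mul_one, mul_assoc X q]
    · change sandwich (m + 1) p q Y = sandwich (0 + 1) p _ Y
      rw [sandwich_Y, sandwich_Y, pow_zero, mul_one, mul_assoc X q]
  | mul a b ha hb => intro p q; rw [sandwich_mul, sandwich_mul, ha, hb, mul_assoc]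
  | add a b ha hb => intro p q; rw [map_add, map_add, ha, hb]

theorem sandwich_one_swap (a : H) : ∀ p q : H, sandwich 1 p q a = sandwich 1 1 (q * p) a := by
  induction a using FreeAlgebra.induction with
  | grade0 r => intro p q; rw [Algebra.algebraMap_eq_smul_one]; simp [sandwich_one]
  | grade1 l =>
    intro p q
    cases l
    · change sandwich (0 + 1) p q X = sandwich (0 + 1) 1 _ X
      rw [sandwich_X, sandwich_X, pow_zero, mul_one, mul_one, mul_one, mul_assoc X q]
    · change sandwich (0 + 1) p q Y = sandwich (0 + 1) 1 _ Y
      rw [sandwich_Y, sandwich_Y, pow_zero, mul_one, mul_one, mul_one, mul_assoc X q]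
  | mul a b ha hb =>
    intro p q
    rw [sandwich_mul, sandwich_mul, ha, hb, hb (1 * a), one_mul]
    simp only [mul_assoc]
  | add a b ha hb => intro p q; rw [map_add, map_add, ha, hb]

/-- The values on `x` and `y` are opposite, so the derivation vanishes on `z` and on its powers. -/
theorem sandwich_one_pow_X_add_Y (p q : H) (m : ℕ) : sandwich 1 p q ((X + Y) ^ m) = 0 := by
  induction m generalizing p q with
  | zero => rw [pow_zero, sandwich_one]
  | succ m ih =>
    rw [pow_succ, sandwich_mul, ih, map_add, sandwich_X 0, sandwich_Y 0, add_neg_cancel, add_zero]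

/-- `ρ_n(a) = ρ_1(a z^{n-1})`. -/
theorem rho_succ (m : ℕ) (a : H) : rho (m + 1) a = rho 1 (a * (X + Y) ^ m) := by
  rw [rho_eq_sandwich, rho_eq_sandwich, sandwich_succ, sandwich_mul, sandwich_one_pow_X_add_Y,
    one_mul, mul_one, add_zero]

/-- The cyclic derivation `a ↦ M_1(𝒞_1(a) ⋄ q)`. -/
noncomputable def cyc (q : H) : H →ₗ[ℚ] H := sandwich 1 1 q

theorem cyc_X (q : H) : cyc q X = X * q * Y := by
  rw [cyc, sandwich_X 0, pow_zero, mul_one, mul_one]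

theorem cyc_Y (q : H) : cyc q Y = -(X * q * Y) := by
  rw [cyc, sandwich_Y 0, pow_zero, mul_one, mul_one]

theorem cyc_mul (q a b : H) : cyc q (a * b) = cyc (b * q) a + cyc (q * a) b := by
  rw [cyc, sandwich_mul, one_mul, sandwich_one_swap b a q]; rfl

theorem rho_one_eq_cyc (a : H) : rho 1 a = cyc 1 a := rho_eq_sandwich 1 a

/-- Exchanging `a` and `b` exchanges the two terms of `cyc_mul`. -/
theorem rho_one_mul_comm (a b : H) : rho 1 (a * b) = rho 1 (b * a) := by
  rw [rho_one_eq_cyc, rho_one_eq_cyc, cyc_mul, cyc_mul, add_comm, one_mul, one_mul, mul_one,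
    mul_one]

/-! ### The value of `ρ_1` on `z_{k_1} ⋯ z_{k_l}` -/

theorem cyc_pow_X (q : H) (m : ℕ) :
    cyc q (X ^ m) = ∑ i ∈ Finset.range m, X ^ (m - i) * q * X ^ i * Y := by
  induction m generalizing q with
  | zero => rw [pow_zero, Finset.range_zero, Finset.sum_empty]; exact sandwich_one 1 1 q
  | succ m ih =>
    rw [pow_succ', cyc_mul, cyc_X, ih, Finset.sum_range_succ', add_comm]
    congr 1
    · refine Finset.sum_congr rfl fun i _ => ?_
      rw [Nat.add_sub_add_right, pow_succ']
      simp only [mul_assoc]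
    · rw [Nat.sub_zero, pow_succ', pow_zero, mul_one, ← mul_assoc X]

theorem zword_cons (a : ℕ) (k : List ℕ) : zword (a :: k) = zgen a * zword k := by
  simp [zword]

theorem zword_append (k k' : List ℕ) : zword (k ++ k') = zword k * zword k' := by
  simp [zword]

theorem zword_succ_cons {a : ℕ} (ha : 1 ≤ a) (k : List ℕ) :
    zword ((a + 1) :: k) = X * zword (a :: k) := by
  obtain ⟨b, rfl⟩ := Nat.exists_eq_add_of_le' ha
  simp only [zword_cons, zgen, Nat.add_sub_cancel]
  rw [pow_succ']
  simp only [mul_assoc]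

/-- In `z_a = x^(a-1) y`, each letter `x` contributes one term of the sum and the letter `y` the
negative term. -/
theorem cyc_zgen (k : List ℕ) {a : ℕ} (ha : 1 ≤ a) :
    cyc (zword k) (zgen a) =
      (∑ i ∈ Finset.Icc 1 (a - 1), zword ((a - i + 1) :: k ++ [i])) - X * zword (k ++ [a]) := by
  obtain ⟨m, rfl⟩ := Nat.exists_eq_add_of_le' ha
  have h : ∀ i ∈ Finset.range m, X ^ (m - i) * (Y * zword k) * X ^ i * Y =
      zword ((m + 1 - (i + 1) + 1) :: k ++ [i + 1]) := fun i _ => by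
    rw [zword_append, zword_cons, Nat.add_sub_add_right]
    simp [zgen, zword, mul_assoc]
  rw [zgen, Nat.add_sub_cancel, cyc_mul, cyc_Y, cyc_pow_X, sub_eq_add_neg,
    Finset.sum_congr rfl h, ← Finset.Ico_add_one_right_eq_Icc,
    Finset.sum_Ico_eq_sum_range, Nat.add_sub_cancel, zword_append]
  simp [zgen, zword, mul_assoc, add_comm]

/-- When one factor is differentiated, the factors after it, then `q`, then the factors before it
are what gets inserted. -/
theorem cyc_zword (q : H) (k : List ℕ) :
    cyc q (zword k) = ∑ j : Fin k.length,
      cyc (zword (k.drop (j + 1)) * q * zword (k.take j)) (zgen (k.get j)) := by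
  induction k generalizing q with
  | nil => exact sandwich_one 1 1 q
  | cons a k ih =>
    rw [zword_cons, cyc_mul, ih]
    simp only [List.length_cons]
    rw [Fin.sum_univ_succ]
    congr 1
    · simp [zword]
    · refine Finset.sum_congr rfl fun j _ => ?_
      simp [zword_cons, mul_assoc]

theorem tail_rotate (k : List ℕ) (j : Fin k.length) :
    (k.rotate j).tail = k.drop (j + 1) ++ k.take j := by
  rw [List.rotate_eq_drop_append_take j.2.le, List.drop_eq_getElem_cons j.2]
  rfl

theorem rotate_eq_cons (k : List ℕ) (j : Fin k.length) :
    k.rotate j = k.get j :: (k.rotate j).tail := by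
  rw [tail_rotate, List.rotate_eq_drop_append_take j.2.le, List.drop_eq_getElem_cons j.2]
  rfl

theorem tail_rotate_append (k : List ℕ) (j : Fin k.length) :
    (k.rotate j).tail ++ [k.get j] = k.rotate (j + 1) := by
  rw [← List.rotate_rotate, rotate_eq_cons k j, List.rotate_cons_succ, List.rotate_zero]
  rfl

/-- Shifting the summation over all rotations. -/
theorem sum_rotate_succ {A : Type*} [AddCommMonoid A] (f : List ℕ → A) (k : List ℕ) :
    ∑ j : Fin k.length, f (k.rotate (j + 1)) = ∑ j : Fin k.length, f (k.rotate j) := by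
  rw [Finset.sum_range (fun j => f (k.rotate (j + 1))) |>.symm,
    Finset.sum_range (fun j => f (k.rotate j)) |>.symm]
  have h := k.rotate_length
  generalize k.length = l at h ⊢
  cases l with
  | zero => rfl
  | succ l =>
    rw [Finset.sum_range_succ, h, Finset.sum_range_succ' (fun j => f (k.rotate j)),
      List.rotate_zero]

theorem rho_one_zword (k : List ℕ) (hk : ∀ a ∈ k, 1 ≤ a) :
    rho 1 (zword k) =
      (∑ j : Fin k.length, ∑ i ∈ Finset.Icc 1 (k.get j - 1),
        zword ((k.get j - i + 1) :: (k.rotate j).tail ++ [i])) -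
      ∑ j : Fin k.length, zword ((k.get j + 1) :: (k.rotate j).tail) := by
  have h1 : ∀ j : Fin k.length, 1 ≤ k.get j := fun j => hk _ (List.get_mem k j)
  have h2 : ∀ j : Fin k.length, zword ((k.get j + 1) :: (k.rotate j).tail) =
      X * zword (k.rotate j) := fun j => by
    rw [zword_succ_cons (h1 j), ← rotate_eq_cons]
  simp only [h2]
  -- The negative term from factor `j` is `X` times rotation `j + 1`, not `j`; the shift of the
  -- cyclic sum repairs this.
  rw [rho_one_eq_cyc, cyc_zword, ← sum_rotate_succ (fun l => X * zword l), ← Finset.sum_sub_distrib]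
  refine Finset.sum_congr rfl fun j _ => ?_
  rw [mul_one, ← zword_append, ← tail_rotate, cyc_zgen _ (h1 j), tail_rotate_append]

/-! ### Reduction of words to the indices `z_{k_1} ⋯ z_{k_l}` -/

theorem word_append (u v : List Letter) : word (u ++ v) = word u * word v := by simp [word]

theorem word_cons (a : Letter) (u : List Letter) : word (a :: u) = FreeAlgebra.ι ℚ a * word u := by
  simp [word]

/-- The last clause turns the presence of an `x` into the entry exceeding 1 that convergence
requires. -/
theorem exists_zword_eq_word_append_y (w : List Letter) :
    ∃ (a : ℕ) (k : List ℕ), (∀ b ∈ a :: k, 1 ≤ b) ∧ zword (a :: k) = word (w ++ [Letter.y]) ∧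
      (Letter.x ∈ w → ∃ b ∈ a :: k, 1 < b) := by
  induction w with
  | nil => exact ⟨1, [], by simp, by simp [zword, zgen, word, Y], by simp⟩
  | cons c w ih =>
    obtain ⟨a, k, h1, h2, h3⟩ := ih
    cases c with
    | x =>
      refine ⟨a + 1, k, ?_, ?_, fun _ => ⟨a + 1, by simp, ?_⟩⟩
      · intro b hb
        rcases List.mem_cons.1 hb with rfl | hb
        · omega
        · exact h1 b (List.mem_cons_of_mem _ hb)
      · rw [zword_succ_cons (h1 a (by simp)), h2, List.cons_append, word_cons]; rfl
      · have := h1 a (by simp); omega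
    | y =>
      refine ⟨1, a :: k, ?_, ?_, fun h => ?_⟩
      · intro b hb
        rcases List.mem_cons.1 hb with rfl | hb
        · exact le_rfl
        · exact h1 b hb
      · rw [zword_cons, h2, List.cons_append, word_cons]; simp [zgen, Y]
      · obtain ⟨b, hb, hb'⟩ := h3 (by simpa using h)
        exact ⟨b, List.mem_cons_of_mem _ hb, hb'⟩

theorem exists_zword_eq_mul_Y (a : ℕ) (k : List ℕ) : ∃ v : H, zword (a :: k) = v * Y := by
  rcases List.eq_nil_or_concat (a :: k) with h | ⟨l, b, h⟩
  · simp at h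
  · refine ⟨zword l * X ^ (b - 1), ?_⟩
    rw [h, List.concat_eq_append, zword_append]
    simp [zword, zgen, mul_assoc]

theorem zword_mem_H0 {a : ℕ} (ha : 1 ≤ a) (k : List ℕ) : zword ((a + 1) :: k) ∈ H0 := by
  obtain ⟨v, hv⟩ := exists_zword_eq_mul_Y a k
  exact ⟨0, v, by rw [zword_succ_cons ha, hv, map_zero, zero_add, mul_assoc]⟩

theorem ZAux_zword {a : ℕ} (ha : 1 ≤ a) {k : List ℕ} (hk : ∀ b ∈ k, 1 ≤ b) :
    ZAux (zword ((a + 1) :: k)) = mzv ((a + 1) :: k) := by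
  refine Z_zword _ (fun b hb => ?_) (zword_mem_H0 ha k)
  rcases List.mem_cons.1 hb with rfl | hb
  · omega
  · exact hk b hb

theorem mem_map_ker_Z {a : H} (h : a ∈ H0) (h' : ZAux a = 0) :
    a ∈ Submodule.map H0.val.toLinearMap (LinearMap.ker Z) :=
  ⟨⟨a, h⟩, h', rfl⟩

/-- The cyclic sum formula for a single index. -/
def CyclicSumFormula (k : List ℕ) : Prop :=
  (∑ j : Fin k.length, ∑ i ∈ Finset.Icc 1 (k.get j - 1),
    mzv ((k.get j - i + 1) :: (k.rotate j).tail ++ [i])) =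
  ∑ j : Fin k.length, mzv ((k.get j + 1) :: (k.rotate j).tail)

theorem rho_one_zword_mem (k : List ℕ) (hk : ∀ a ∈ k, 1 ≤ a) (h : CyclicSumFormula k) :
    rho 1 (zword k) ∈ Submodule.map H0.val.toLinearMap (LinearMap.ker Z) := by
  have ht : ∀ j : Fin k.length, ∀ b ∈ (k.rotate j).tail, 1 ≤ b := fun j b hb =>
    hk b (List.mem_rotate.1 (List.mem_of_mem_tail hb))
  have h1 : ∀ j : Fin k.length, 1 ≤ k.get j := fun j => hk _ (List.get_mem k j)
  have hi : ∀ j : Fin k.length, ∀ i ∈ Finset.Icc 1 (k.get j - 1), 1 ≤ k.get j - i := by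
    intro j i hi
    have := Finset.mem_Icc.1 hi
    omega
  have ht' : ∀ j : Fin k.length, ∀ i ∈ Finset.Icc 1 (k.get j - 1),
      ∀ b ∈ (k.rotate j).tail ++ [i], 1 ≤ b := by
    intro j i hi b hb
    rcases List.mem_append.1 hb with hb | hb
    · exact ht j b hb
    · rw [List.mem_singleton.1 hb]
      exact (Finset.mem_Icc.1 hi).1
  rw [rho_one_zword k hk]
  refine mem_map_ker_Z (sub_mem ?_ ?_) ?_
  · exact sum_mem fun j _ => sum_mem fun i hij => zword_mem_H0 (hi j i hij) _
  · exact sum_mem fun j _ => zword_mem_H0 (h1 j) _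
  · rw [map_sub, map_sum, map_sum, sub_eq_zero]
    refine Eq.trans ?_ (h.trans ?_)
    · refine Finset.sum_congr rfl fun j _ => ?_
      rw [map_sum]
      exact Finset.sum_congr rfl fun i hij => ZAux_zword (hi j i hij) (ht' j i hij)
    · exact Finset.sum_congr rfl fun j _ => (ZAux_zword (h1 j) (ht j)).symm

theorem rho_one_word_mem
    (hcsf : ∀ k : List ℕ, (∀ a ∈ k, 1 ≤ a) → (∃ a ∈ k, 1 < a) → CyclicSumFormula k)
    (w : List Letter) (hx : Letter.x ∈ w) (hy : Letter.y ∈ w) :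
    rho 1 (word w) ∈ Submodule.map H0.val.toLinearMap (LinearMap.ker Z) := by
  obtain ⟨u, v, rfl⟩ := List.append_of_mem hy
  have h : rho 1 (word (u ++ Letter.y :: v)) = rho 1 (word ((v ++ u) ++ [Letter.y])) := by
    rw [← List.singleton_append, ← List.append_assoc, word_append, rho_one_mul_comm, ← word_append,
      List.append_assoc]
  obtain ⟨a, k, h1, h2, h3⟩ := exists_zword_eq_word_append_y (v ++ u)
  rw [h, ← h2]
  refine rho_one_zword_mem _ h1 (hcsf _ h1 (h3 ?_))
  simpa [or_comm] using hx

/-- Expanding one factor `z` appends a letter to the word, which keeps both `x` and `y` in it. -/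
theorem rho_one_word_mul_pow_mem
    (hcsf : ∀ k : List ℕ, (∀ a ∈ k, 1 ≤ a) → (∃ a ∈ k, 1 < a) → CyclicSumFormula k) (m : ℕ) :
    ∀ w : List Letter, Letter.x ∈ w → Letter.y ∈ w →
      rho 1 (word w * (X + Y) ^ m) ∈ Submodule.map H0.val.toLinearMap (LinearMap.ker Z) := by
  induction m with
  | zero =>
    intro w hx hy
    rw [pow_zero, mul_one]
    exact rho_one_word_mem hcsf w hx hy
  | succ m ih =>
    intro w hx hy
    have h : word w * (X + Y) ^ (m + 1) =
        word (w ++ [Letter.x]) * (X + Y) ^ m + word (w ++ [Letter.y]) * (X + Y) ^ m := by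
      rw [pow_succ', ← mul_assoc, mul_add, add_mul, word_append, word_append]
      simp [word, X, Y]
    rw [h, map_add]
    exact add_mem (ih _ (by simp [hx]) (by simp [hy])) (ih _ (by simp [hx]) (by simp [hy]))

theorem word_eq_pow_of_notMem_x (w : List Letter) (hx : Letter.x ∉ w) : word w = Y ^ w.length := by
  induction w with
  | nil => simp [word]
  | cons c w ih =>
    cases c with
    | x => simp at hx
    | y => rw [word_cons, ih (by simpa using hx), List.length_cons, pow_succ']; rfl

theorem y_mem_of_word_mem_H1 (w : List Letter) (hx : Letter.x ∈ w) (h : word w ∈ H1) :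
    Letter.y ∈ w := by
  by_contra hy
  have hw : ∀ w : List Letter, Letter.y ∉ w → word w = X ^ w.length := by
    intro w hy
    induction w with
    | nil => simp [word]
    | cons c w ih =>
      cases c with
      | y => simp at hy
      | x => rw [word_cons, ih (by simpa using hy), List.length_cons, pow_succ']; rfl
  obtain ⟨c, v, hv⟩ := h
  rw [hw w hy] at hv
  have hl : w.length ≠ 0 := by
    intro h0
    rw [List.length_eq_zero_iff.1 h0] at hx
    simp at hx
  -- Evaluating at `x = r`, `y = 0` turns `x^l = c + v y` into `r^l = c` for all `r`, which is
  -- absurd at `r = 0` and `r = 1`.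
  let φ (r : ℚ) : H →ₐ[ℚ] ℚ := FreeAlgebra.lift ℚ fun
    | Letter.x => r
    | Letter.y => 0
  have hφX : ∀ r, φ r X = r := fun r => by simp [φ, X]
  have hφY : ∀ r, φ r Y = 0 := fun r => by simp [φ, Y]
  have h : ∀ r : ℚ, r ^ w.length = c := fun r => by
    have := congrArg (φ r) hv
    rwa [map_pow, map_add, map_mul, hφX, hφY, mul_zero, add_zero, AlgHom.commutes] at this
  have h0 := h 0
  have h1 := h 1
  rw [zero_pow hl] at h0
  rw [one_pow] at h1
  exact one_ne_zero (h1.trans h0.symm)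

theorem map_rho_H1check_le
    (hcsf : ∀ k : List ℕ, (∀ a ∈ k, 1 ≤ a) → (∃ a ∈ k, 1 < a) → CyclicSumFormula k) (m : ℕ) :
    Submodule.map (rho (m + 1)) H1check ≤
      Submodule.map H0.val.toLinearMap (LinearMap.ker Z) := by
  rw [Submodule.map_le_iff_le_comap, H1check, Submodule.span_le]
  rintro _ ⟨⟨w, rfl⟩, h, hm⟩
  have hx : Letter.x ∈ w := by
    by_contra hx
    exact hm _ (word_eq_pow_of_notMem_x w hx)
  rw [SetLike.mem_coe, Submodule.mem_comap, rho_succ]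
  exact rho_one_word_mul_pow_mem hcsf m w hx (y_mem_of_word_mem_H1 w hx h)

/-! ### Nested sums in `[0, ∞]` -/

open ENNReal

/-- The weight `n ^ (-a)`, and `0` for `n = 0`. -/
noncomputable def wt (a n : ℕ) : ℝ≥0∞ := if n = 0 then 0 else ((n : ℝ≥0∞) ^ a)⁻¹

/-- `∑_{n_1 > ⋯ > n_l > 0} n_1 ^ (-k_1) ⋯ n_l ^ (-k_l) Φ(n_1, n_l)`. -/
noncomputable def chain : List ℕ → (ℕ → ℕ → ℝ≥0∞) → ℝ≥0∞
  | [], _ => 0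
  | [a], Φ => ∑' n, wt a n * Φ n n
  | a :: b :: k, Φ => chain (b :: k) fun M m => ∑' n, if M < n then wt a n * Φ n m else 0

theorem chain_cons (a : ℕ) {k : List ℕ} (hk : k ≠ []) (Φ : ℕ → ℕ → ℝ≥0∞) :
    chain (a :: k) Φ = chain k fun M m => ∑' n, if M < n then wt a n * Φ n m else 0 := by
  cases k with
  | nil => exact absurd rfl hk
  | cons b k => rfl

/-- Comparison for `0 < m ≤ M` suffices: `wt` vanishes at 0, and the two arguments are the smallest
and largest summation variables. -/
theorem chain_mono (k : List ℕ) : ∀ {Φ Ψ : ℕ → ℕ → ℝ≥0∞},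
    (∀ M m, 0 < m → m ≤ M → Φ M m ≤ Ψ M m) → chain k Φ ≤ chain k Ψ := by
  induction k with
  | nil => intro Φ Ψ _; exact le_rfl
  | cons a k ih =>
    intro Φ Ψ h
    cases k with
    | nil =>
      refine ENNReal.tsum_le_tsum fun n => ?_
      rcases Nat.eq_zero_or_pos n with rfl | hn
      · simp [wt]
      · exact mul_le_mul_right (h n n hn le_rfl) _
    | cons b k =>
      refine ih fun M m hm hM => ENNReal.tsum_le_tsum fun n => ?_
      split_ifs with hn
      · exact mul_le_mul_right (h n m hm (hM.trans hn.le)) _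
      · exact le_rfl

theorem chain_congr (k : List ℕ) {Φ Ψ : ℕ → ℕ → ℝ≥0∞}
    (h : ∀ M m, 0 < m → m ≤ M → Φ M m = Ψ M m) : chain k Φ = chain k Ψ :=
  le_antisymm (chain_mono k fun M m h1 h2 => (h M m h1 h2).le)
    (chain_mono k fun M m h1 h2 => (h M m h1 h2).ge)

theorem chain_zero (k : List ℕ) : (chain k fun _ _ => 0) = 0 := by
  induction k with
  | nil => rfl
  | cons a k ih => cases k <;> simp [chain, ih]

theorem chain_add (k : List ℕ) : ∀ Φ Ψ : ℕ → ℕ → ℝ≥0∞,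
    (chain k fun M m => Φ M m + Ψ M m) = chain k Φ + chain k Ψ := by
  induction k with
  | nil => intro Φ Ψ; simp [chain]
  | cons a k ih =>
    intro Φ Ψ
    cases k with
    | nil => simp only [chain, mul_add, ENNReal.tsum_add]
    | cons b k =>
      rw [chain, chain, chain, ← ih]
      refine chain_congr _ fun M m _ _ => ?_
      rw [← ENNReal.tsum_add]
      refine tsum_congr fun n => ?_
      split_ifs
      · rw [mul_add]
      · rw [add_zero]

theorem chain_sum (k : List ℕ) (s : Finset ℕ) (Φ : ℕ → ℕ → ℕ → ℝ≥0∞) :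
    (chain k fun M m => ∑ i ∈ s, Φ i M m) = ∑ i ∈ s, chain k (Φ i) := by
  classical
  induction s using Finset.induction_on with
  | empty => simpa using chain_zero k
  | insert i s hi ih =>
    simp only [Finset.sum_insert hi]
    rw [chain_add, ih]

/-- The definition peels off the largest variable; by Tonelli the smallest can be peeled off
instead. Having both is what lets an entry move from the front of the index to its end. -/
theorem chain_snoc (b : ℕ) (k : List ℕ) (hk : k ≠ []) : ∀ Φ : ℕ → ℕ → ℝ≥0∞,
    chain (k ++ [b]) Φ = chain k fun M m => ∑' p, if p < m then wt b p * Φ M p else 0 := by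
  induction k with
  | nil => exact absurd rfl hk
  | cons a k ih =>
    intro Φ
    cases k with
    | nil =>
      simp only [List.cons_append, List.nil_append, chain, ← ENNReal.tsum_mul_left]
      rw [ENNReal.tsum_comm]
      refine tsum_congr fun n => tsum_congr fun p => ?_
      split_ifs
      · exact mul_left_comm _ _ _
      · rw [mul_zero, mul_zero]
    | cons c k =>
      rw [List.cons_append, chain_cons a (by simp), ih (by simp), chain_cons a (List.cons_ne_nil c k)]
      refine chain_congr _ fun M m _ _ => ?_
      have h1 : ∀ p n : ℕ, (if p < m then wt b p * (if M < n then wt a n * Φ n p else 0) else 0) =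
          if M < n then wt a n * (if p < m then wt b p * Φ n p else 0) else 0 := by
        intro p n
        split_ifs <;> simp [mul_left_comm]
      have h2 : ∀ p, (if p < m then wt b p * ∑' n, (if M < n then wt a n * Φ n p else 0) else 0) =
          ∑' n, if p < m then wt b p * (if M < n then wt a n * Φ n p else 0) else 0 := by
        intro p
        split_ifs
        · rw [ENNReal.tsum_mul_left]
        · rw [tsum_zero]
      have h3 : ∀ n, (if M < n then wt a n * ∑' p, (if p < m then wt b p * Φ n p else 0) else 0) =
          ∑' p, if M < n then wt a n * (if p < m then wt b p * Φ n p else 0) else 0 := by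
        intro n
        split_ifs
        · rw [ENNReal.tsum_mul_left]
        · rw [tsum_zero]
      simp only [h2, h3, h1]
      exact ENNReal.tsum_comm

theorem wt_zero_mul (a n : ℕ) : wt 0 n * wt a n = wt a n := by
  simp only [wt]; split_ifs <;> simp

theorem wt_succ (a n : ℕ) : wt (a + 1) n = wt a n * (n : ℝ≥0∞)⁻¹ := by
  simp only [wt]
  split_ifs with h
  · simp
  · rw [pow_succ, ENNReal.mul_inv (Or.inr (by simp)) (Or.inl (by simp))]

/-- A final exponent 0 stands for a smallest variable that is positive but unweighted, a common form
for series with different last exponents. -/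
theorem chain_snoc_weight (k : List ℕ) (b : ℕ) (Φ : ℕ → ℕ → ℝ≥0∞) :
    chain (k ++ [b]) Φ = chain (k ++ [0]) fun M m => wt b m * Φ M m := by
  by_cases hk : k = []
  · subst hk
    simp only [List.nil_append, chain, ← mul_assoc, wt_zero_mul]
  · simp only [chain_snoc _ k hk, ← mul_assoc, wt_zero_mul]

theorem chain_cons_succ (k : List ℕ) (a : ℕ) (Φ : ℕ → ℕ → ℝ≥0∞) :
    chain ((a + 1) :: k) Φ = chain (a :: k) fun M m => (M : ℝ≥0∞)⁻¹ * Φ M m := by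
  cases k with
  | nil => simp only [chain, wt_succ, mul_assoc]
  | cons b k => simp only [chain, wt_succ, mul_assoc]

/-- `∑_{n_1 > ⋯ > n_l > 0} n_1 ^ (-k_1) ⋯ n_l ^ (-k_l)` in `[0, ∞]`. -/
noncomputable def ezeta (k : List ℕ) : ℝ≥0∞ := chain k fun _ _ => 1

/-- `∑_{n_1 > ⋯ > n_l > q ≥ 0} n_1 ^ (-k_1) ⋯ n_l ^ (-k_l) (n_1 - q)⁻¹` in `[0, ∞]`. -/
noncomputable def cyclicSeries (k : List ℕ) : ℝ≥0∞ :=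
  chain k fun M m => ∑ q ∈ Finset.range m, ((M - q : ℕ) : ℝ≥0∞)⁻¹

/-! ### Partial fractions and the effect of one rotation on `cyclicSeries` -/

theorem inv_mul_inv_add (p d : ℕ) (hp : 0 < p) (hd : 0 < d) :
    ((p + d : ℕ) : ℝ≥0∞)⁻¹ * (d : ℝ≥0∞)⁻¹ + ((p + d : ℕ) : ℝ≥0∞)⁻¹ * (p : ℝ≥0∞)⁻¹ =
      (p : ℝ≥0∞)⁻¹ * (d : ℝ≥0∞)⁻¹ := by
  have h : ∀ n : ℕ, 0 < n → ((n : ℝ≥0∞)⁻¹) = ENNReal.ofReal ((n : ℝ)⁻¹) := fun n hn => by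
    rw [ENNReal.ofReal_inv_of_pos (by exact_mod_cast hn), ENNReal.ofReal_natCast]
  rw [h _ hp, h _ hd, h _ (by omega : 0 < p + d), ← ENNReal.ofReal_mul (by positivity),
    ← ENNReal.ofReal_mul (by positivity), ← ENNReal.ofReal_mul (by positivity),
    ← ENNReal.ofReal_add (by positivity) (by positivity)]
  congr 1
  have hp' : (p : ℝ) ≠ 0 := by exact_mod_cast hp.ne'
  have hd' : (d : ℝ) ≠ 0 := by exact_mod_cast hd.ne'
  have : (p : ℝ) + d ≠ 0 := by positivity
  push_cast
  field_simp

theorem inv_mul_inv_sub {p n : ℕ} (hp : 0 < p) (hn : p < n) :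
    (n : ℝ≥0∞)⁻¹ * ((n - p : ℕ) : ℝ≥0∞)⁻¹ + (n : ℝ≥0∞)⁻¹ * (p : ℝ≥0∞)⁻¹ =
      (p : ℝ≥0∞)⁻¹ * ((n - p : ℕ) : ℝ≥0∞)⁻¹ := by
  obtain ⟨d, rfl⟩ := Nat.exists_eq_add_of_lt hn
  have := inv_mul_inv_add p (d + 1) hp (by omega)
  rwa [show p + d + 1 - p = d + 1 by omega, add_assoc p]

/-- A telescoping series. -/
theorem tsum_gt_wt_one {p M : ℕ} (hp : 0 < p) (hM : p ≤ M) :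
    (∑' n, if M < n then wt 1 n * ((n - p : ℕ) : ℝ≥0∞)⁻¹ else 0) =
      wt 1 p * ∑ q ∈ Finset.range p, ((M - q : ℕ) : ℝ≥0∞)⁻¹ := by
  have hinj : Function.Injective fun r : ℕ => M + 1 + r := fun r s h => by simpa using h
  rw [← hinj.tsum_eq]
  swap
  · intro n hn
    have : M < n := by
      by_contra h
      simp [h] at hn
    exact ⟨n - (M + 1), by simp only; omega⟩
  obtain ⟨p, rfl⟩ := Nat.exists_eq_add_of_le' hp
  -- `g N` is the tail left after `N` terms: `1/(n(n-p)) = (1/p)(1/(n-p) - 1/n)` telescopes with gap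
  -- `p`, leaving `p` boundary terms. The identity is kept additive, since subtraction in `[0, ∞]`
  -- truncates.
  set g : ℕ → ℝ≥0∞ := fun N =>
    ((p + 1 : ℕ) : ℝ≥0∞)⁻¹ * ∑ q ∈ Finset.range (p + 1), ((M + N - q : ℕ) : ℝ≥0∞)⁻¹ with hg
  set t : ℕ → ℝ≥0∞ := fun r => if M < M + 1 + r then
    wt 1 (M + 1 + r) * ((M + 1 + r - (p + 1) : ℕ) : ℝ≥0∞)⁻¹ else 0 with ht
  have hstep : ∀ N, t N + g (N + 1) = g N := by
    intro N
    have h1 : ∀ q, M + (N + 1) - (q + 1) = M + N - q := fun q => by omega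
    have h2 := inv_mul_inv_sub (n := M + 1 + N) hp (by omega)
    simp only [hg, ht]
    rw [Finset.sum_range_succ', Finset.sum_range_succ, if_pos (by omega), mul_add, mul_add,
      add_left_comm]
    simp only [h1]
    congr 1
    rw [wt, if_neg (by omega), pow_one, show M + N - p = M + 1 + N - (p + 1) by omega, ← h2,
      show M + (N + 1) - 0 = M + 1 + N by omega, mul_comm _ ((p + 1 : ℕ) : ℝ≥0∞)⁻¹,
      mul_comm ((p + 1 : ℕ) : ℝ≥0∞)⁻¹]
  have hpart : ∀ N, ∑ r ∈ Finset.range N, t r + g N = g 0 := by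
    intro N
    induction N with
    | zero => simp
    | succ N ih => rw [Finset.sum_range_succ, add_assoc, hstep, ih]
  have hlim : Filter.Tendsto g Filter.atTop (nhds 0) := by
    have h1 : ∀ q, Filter.Tendsto (fun N : ℕ => ((M + N - q : ℕ) : ℝ≥0∞)⁻¹) Filter.atTop
        (nhds 0) := fun q =>
      ENNReal.tendsto_inv_nat_nhds_zero.comp
        (Filter.tendsto_atTop_mono (fun N => by omega : ∀ N, N - q ≤ M + N - q)
          (Filter.tendsto_sub_atTop_nat q))
    have h2 := ENNReal.Tendsto.const_mul (a := ((p + 1 : ℕ) : ℝ≥0∞)⁻¹)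
      (tendsto_finsetSum (Finset.range (p + 1)) fun q _ => h1 q) (Or.inr (by simp))
    simp only [Finset.sum_const_zero, mul_zero] at h2
    exact h2
  have h := (ENNReal.tendsto_nat_tsum t).add hlim
  simp only [hpart, add_zero] at h
  refine (tendsto_nhds_unique h tendsto_const_nhds).trans ?_
  simp [hg, wt]

theorem tsum_gt_wt_succ {p M : ℕ} (a : ℕ) (hp : 0 < p) (hM : p ≤ M) :
    (∑' n, if M < n then wt (a + 1) n * ((n - p : ℕ) : ℝ≥0∞)⁻¹ else 0) +
        wt 1 p * (∑' n, if M < n then wt (a + 1) n else 0) =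
      wt 1 p * ∑' n, if M < n then wt a n * ((n - p : ℕ) : ℝ≥0∞)⁻¹ else 0 := by
  rw [← ENNReal.tsum_mul_left, ← ENNReal.tsum_mul_left, ← ENNReal.tsum_add]
  refine tsum_congr fun n => ?_
  split_ifs with h
  · have h2 := inv_mul_inv_sub (n := n) hp (by omega)
    have h3 : wt 1 p = (p : ℝ≥0∞)⁻¹ := by rw [wt, if_neg hp.ne', pow_one]
    rw [wt_succ, h3]
    calc _ = wt a n * ((n : ℝ≥0∞)⁻¹ * ((n - p : ℕ) : ℝ≥0∞)⁻¹ + (n : ℝ≥0∞)⁻¹ * (p : ℝ≥0∞)⁻¹) := by ring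
      _ = _ := by rw [h2, mul_left_comm]
  · simp

theorem wt_succ' (a n : ℕ) : wt (a + 1) n = wt 1 n * wt a n := by
  rw [wt_succ, mul_comm]
  simp only [wt]
  split_ifs <;> simp

/-- The partial fraction identity behind the cyclic sum formula. -/
theorem tsum_gt_wt {p M : ℕ} (hp : 0 < p) (hM : p ≤ M) (a : ℕ) :
    (∑' n, if M < n then wt (a + 1) n * ((n - p : ℕ) : ℝ≥0∞)⁻¹ else 0) +
        ∑ i ∈ Finset.Icc 1 a, wt i p * (∑' n, if M < n then wt (a + 1 - i + 1) n else 0) =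
      wt (a + 1) p * ∑ q ∈ Finset.range p, ((M - q : ℕ) : ℝ≥0∞)⁻¹ := by
  induction a with
  | zero => simpa using tsum_gt_wt_one hp hM
  | succ a ih =>
    have hs : ∀ F : ℕ → ℝ≥0∞,
        ∑ i ∈ Finset.Icc 1 (a + 1), F i = F 1 + ∑ i ∈ Finset.Icc 1 a, F (i + 1) := fun F => by
      rw [← Finset.Ico_add_one_right_eq_Icc, ← Finset.Ico_add_one_right_eq_Icc,
        Finset.sum_eq_sum_Ico_succ_bot (by omega), Finset.sum_Ico_add']
    -- The inductive hypothesis is multiplied by `1/p`: one partial fraction step yields the new `i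
    -- = 1` term, and the old terms shift from `i` to `i + 1`.
    rw [wt_succ' (a + 1), mul_assoc, ← ih, mul_add, ← tsum_gt_wt_succ (a + 1) hp hM, hs,
      Finset.mul_sum]
    refine Eq.trans ?_ (add_assoc _ _ _).symm
    refine congrArg _ (congrArg _ (Finset.sum_congr rfl fun i hi => ?_))
    rw [← mul_assoc, ← wt_succ', Nat.add_sub_add_right]

/-- The term `q = 0` raises the first exponent by one. For `q > 0`, `q` becomes the new smallest
variable `p`, and summing out `n_1` by `tsum_gt_wt` gives `p` the exponent `a + 1` and a fresh
variable below it. -/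
theorem cyclicSeries_rotate (a : ℕ) (k : List ℕ) :
    cyclicSeries ((a + 1) :: k) + ∑ i ∈ Finset.Icc 1 a, ezeta ((a + 1 - i + 1) :: k ++ [i]) =
      ezeta ((a + 2) :: k) + cyclicSeries (k ++ [a + 1]) := by
  have hk : k ++ [0] ≠ [] := by simp
  have h1 : cyclicSeries ((a + 1) :: k) = ezeta ((a + 2) :: k) +
      chain (k ++ [0]) fun M p => ∑' n, if M < n then wt (a + 1) n * ((n - p : ℕ) : ℝ≥0∞)⁻¹ else 0 := by
    rw [← chain_cons (a + 1) hk (fun n p => ((n - p : ℕ) : ℝ≥0∞)⁻¹), ← List.cons_append,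
      chain_snoc _ _ (by simp), ezeta, chain_cons_succ, ← chain_add, cyclicSeries]
    refine chain_congr _ fun M m hm _ => ?_
    obtain ⟨m, rfl⟩ := Nat.exists_eq_add_of_le' hm
    rw [Finset.sum_range_succ', tsum_eq_sum (s := Finset.range (m + 1)), Finset.sum_range_succ',
      add_comm]
    · congr 1
      · simp
      · rw [if_pos (by omega), wt, if_pos rfl, zero_mul, add_zero]
        refine Finset.sum_congr rfl fun q hq => ?_
        rw [if_pos (by simpa using hq), wt, if_neg (by omega), pow_zero, inv_one, one_mul]
    · intro p hp
      rw [if_neg (by simpa using hp)]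
  have h2 : ∀ i, ezeta ((a + 1 - i + 1) :: k ++ [i]) =
      chain (k ++ [0]) fun M p => wt i p * ∑' n, if M < n then wt (a + 1 - i + 1) n else 0 := by
    intro i
    rw [ezeta, List.cons_append, chain_cons _ (by simp), chain_snoc_weight]
    simp only [mul_one]
  rw [h1, add_assoc]
  congr 1
  rw [Finset.sum_congr rfl fun i _ => h2 i, ← chain_sum, ← chain_add, cyclicSeries,
    chain_snoc_weight k (a + 1)]
  exact chain_congr _ fun M p hp hM => tsum_gt_wt hp hM a

/-! ### Finiteness -/

/-- The harmonic numbers in `[0, ∞]`. -/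
noncomputable def eharm (n : ℕ) : ℝ≥0∞ := ∑ q ∈ Finset.range n, ((n - q : ℕ) : ℝ≥0∞)⁻¹

theorem eharm_eq (n : ℕ) : eharm n = ∑ q ∈ Finset.range n, ((q + 1 : ℕ) : ℝ≥0∞)⁻¹ := by
  rw [eharm, ← Finset.sum_range_reflect]
  refine Finset.sum_congr rfl fun q hq => ?_
  have := Finset.mem_range.1 hq
  rw [show n - (n - 1 - q) = q + 1 by omega]

theorem eharm_eq_ofReal (n : ℕ) : eharm n = ENNReal.ofReal (harmonic n : ℝ) := by
  rw [eharm_eq, harmonic, Rat.cast_sum, ENNReal.ofReal_sum_of_nonneg fun i _ => by positivity]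
  refine Finset.sum_congr rfl fun q _ => ?_
  push_cast
  rw [ENNReal.ofReal_inv_of_pos (by positivity), ENNReal.ofReal_add (by positivity) one_pos.le]
  simp

theorem wt_le_inv {a n : ℕ} (ha : 1 ≤ a) : wt a n ≤ (n : ℝ≥0∞)⁻¹ := by
  rw [wt]
  split_ifs with h
  · exact zero_le
  · refine ENNReal.inv_le_inv.2 ?_
    exact_mod_cast Nat.le_self_pow (by omega) n

/-- Each variable other than the largest, `M`, ranges below `M` with weight at most its inverse,
hence costs at most a factor `eharm M`. -/
theorem chain_le_eharm {a : ℕ} (k : List ℕ) (hk : ∀ b ∈ k, 1 ≤ b) : ∀ g : ℕ → ℝ≥0∞,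
    (chain (a :: k) fun M _ => g M) ≤ chain [a] fun M _ => eharm M ^ k.length * g M := by
  induction k using List.reverseRecOn with
  | nil => intro g; simp
  | append_singleton k b ih =>
    intro g
    rw [← List.cons_append, chain_snoc _ _ (by simp)]
    refine le_trans (chain_mono _ (Ψ := fun M _ => eharm M * g M) fun M m hm hM => ?_)
      ((ih (fun c hc => hk c (by simp [hc])) _).trans_eq ?_)
    · rw [tsum_eq_sum (s := Finset.range (M + 1)), Finset.sum_range_succ', eharm_eq,
        Finset.sum_mul]
      · have h0 : wt b 0 = 0 := by simp [wt]
        rw [h0, zero_mul, ite_self, add_zero]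
        refine Finset.sum_le_sum fun q _ => ?_
        split_ifs
        · exact mul_le_mul_left (wt_le_inv (hk b (by simp))) _
        · exact zero_le
      · intro p hp
        rw [if_neg]
        simp at hp
        omega
    · simp only [List.length_append, List.length_singleton, pow_succ, mul_assoc]

theorem summable_harmonic_pow (c : ℕ) :
    Summable fun n : ℕ => (harmonic n : ℝ) ^ c / (n : ℝ) ^ 2 := by
  have h1 : (fun n : ℕ => (harmonic n : ℝ) ^ c / (n : ℝ) ^ 2) =O[Filter.atTop]
      fun n : ℕ => (n : ℝ) ^ (-(3 / 2) : ℝ) := by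
    -- With this exponent the `c`-th power of `1 + log n` is `O(n^(1/2))`, so the terms are
    -- `O(n^(-3/2))`; `c + 1` avoids dividing by 0.
    have hr : (0 : ℝ) < 1 / (2 * (c + 1)) := by positivity
    have hlog : (fun x : ℝ => 1 + Real.log x) =O[Filter.atTop]
        fun x : ℝ => x ^ (1 / (2 * (c + 1)) : ℝ) := by
      refine Asymptotics.IsBigO.add ?_ (isLittleO_log_rpow_atTop hr).isBigO
      exact ((tendsto_rpow_atTop hr).eventually_ge_atTop 1).mono (fun x hx => by
        rw [Real.norm_of_nonneg (by linarith)]; simpa using hx) |> Asymptotics.IsBigO.of_norm_eventuallyLE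
    have hN := (hlog.comp_tendsto tendsto_natCast_atTop_atTop).pow c
    have hh : (fun n : ℕ => (harmonic n : ℝ) ^ c / (n : ℝ) ^ 2) =O[Filter.atTop]
        fun n : ℕ => (1 + Real.log n) ^ c / (n : ℝ) ^ 2 := by
      refine Asymptotics.IsBigO.of_bound 1 (Filter.Eventually.of_forall fun n => ?_)
      have h0 : (0 : ℝ) ≤ harmonic n := by
        simp only [harmonic, Rat.cast_sum]
        exact Finset.sum_nonneg fun i _ => by positivity
      have h2 := harmonic_le_one_add_log n
      rw [one_mul, Real.norm_of_nonneg (by positivity),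
        Real.norm_of_nonneg (div_nonneg (pow_nonneg (h0.trans h2) _) (by positivity))]
      gcongr
    refine hh.trans ?_
    have := hN.mul (Asymptotics.isBigO_refl (fun n : ℕ => ((n : ℝ) ^ 2)⁻¹) Filter.atTop)
    refine (this.congr_left (fun n => by simp [div_eq_mul_inv])).trans ?_
    refine Asymptotics.IsBigO.of_bound 1 ((Filter.eventually_ge_atTop 1).mono fun n hn => ?_)
    have hn' : (1 : ℝ) ≤ n := by exact_mod_cast hn
    have hn0 : (0 : ℝ) < n := by linarith
    simp only [Function.comp_apply]
    rw [one_mul, Real.norm_of_nonneg (by positivity), Real.norm_of_nonneg (by positivity), ← Real.rpow_natCast, ← Real.rpow_mul hn0.le, ← Real.rpow_natCast,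
      ← Real.rpow_neg hn0.le, ← Real.rpow_add hn0]
    refine Real.rpow_le_rpow_of_exponent_le hn' ?_
    have : 1 / (2 * ((c : ℝ) + 1)) * c ≤ 1 / 2 := by
      rw [div_mul_eq_mul_div, div_le_div_iff₀ (by positivity) (by positivity)]
      linarith
    push_cast
    linarith
  exact summable_of_isBigO_nat (Real.summable_nat_rpow.2 (by norm_num)) h1

theorem tsum_wt_mul_eharm_pow_ne_top {a : ℕ} (ha : 2 ≤ a) (c : ℕ) :
    (∑' n, wt a n * eharm n ^ c) ≠ ∞ := by
  refine ne_top_of_le_ne_top (summable_harmonic_pow c).tsum_ofReal_ne_top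
    (ENNReal.tsum_le_tsum fun n => ?_)
  rw [wt]
  split_ifs with h
  · simp
  · have hn : 0 < (n : ℝ) := by exact_mod_cast Nat.pos_of_ne_zero h
    have h0 : (0 : ℝ) ≤ harmonic n := by
      simp only [harmonic, Rat.cast_sum]
      exact Finset.sum_nonneg fun i _ => by positivity
    rw [div_eq_mul_inv, mul_comm, ENNReal.ofReal_mul (by positivity), eharm_eq_ofReal,
      ENNReal.ofReal_pow h0, ENNReal.ofReal_inv_of_pos (by positivity),
      ENNReal.ofReal_pow hn.le, ENNReal.ofReal_natCast]
    refine mul_le_mul_right (ENNReal.inv_le_inv.2 ?_) _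
    exact_mod_cast Nat.pow_le_pow_right (Nat.pos_of_ne_zero h) ha

theorem ezeta_ne_top {a : ℕ} (ha : 2 ≤ a) (k : List ℕ) (hk : ∀ b ∈ k, 1 ≤ b) :
    ezeta (a :: k) ≠ ∞ := by
  refine ne_top_of_le_ne_top (tsum_wt_mul_eharm_pow_ne_top ha k.length)
    ((chain_le_eharm k hk fun _ => 1).trans_eq ?_)
  simp [chain]

/-- The sum over `q` costs only one more harmonic factor. -/
theorem cyclicSeries_ne_top {a : ℕ} (ha : 2 ≤ a) (k : List ℕ) (hk : ∀ b ∈ k, 1 ≤ b) :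
    cyclicSeries (a :: k) ≠ ∞ := by
  refine ne_top_of_le_ne_top (tsum_wt_mul_eharm_pow_ne_top ha (k.length + 1))
    (le_trans (chain_mono _ (Ψ := fun M _ => eharm M) fun M m _ hM => ?_)
      ((chain_le_eharm k hk eharm).trans_eq ?_))
  · exact Finset.sum_le_sum_of_subset (Finset.range_subset_range.2 hM)
  · simp [chain, pow_succ]

/-! ### Comparison with the real series -/

/-- The index set of the series `mzv k`. -/
abbrev Chains (k : List ℕ) : Type :=
  {m : Fin k.length → ℕ // StrictAnti m ∧ ∀ i, 0 < m i}

theorem chain_eq_tsum (k : List ℕ) : ∀ (a : ℕ) (f : ℕ → ℝ≥0∞),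
    (chain (a :: k) fun M _ => f M) =
      ∑' m : Chains (a :: k), (∏ i, wt ((a :: k).get i) (m.1 i)) * f (m.1 (0 : Fin (k.length + 1))) := by
  induction k with
  | nil =>
    intro a f
    have hinj : Function.Injective fun m : Chains [a] => m.1 (0 : Fin 1) := fun m m' h =>
      Subtype.ext (funext fun i => by rw [Fin.fin_one_eq_zero i]; exact h)
    rw [chain, ← hinj.tsum_eq]
    · refine tsum_congr fun m => ?_
      congr 1
      exact (Fin.prod_univ_one fun i : Fin 1 => wt ([a].get i) (m.1 i)).symm
    · intro n hn
      have h0 : 0 < n := by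
        rcases Nat.eq_zero_or_pos n with rfl | h
        · simp [wt] at hn
        · exact h
      exact ⟨⟨fun _ => n, fun i j h => absurd h (by
        rw [Subsingleton.elim (α := Fin 1) i j]; exact lt_irrefl _), fun _ => h0⟩, rfl⟩
  | cons b k ih =>
    intro a f
    rw [chain, ih b (fun M => ∑' n, if M < n then wt a n * f n else 0)]
    simp only [← ENNReal.tsum_mul_left]
    rw [← ENNReal.tsum_prod (f := fun (m : Chains (b :: k)) n =>
      (∏ i, wt ((b :: k).get i) (m.1 i)) *
        if m.1 (0 : Fin (k.length + 1)) < n then wt a n * f n else 0)]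
    let g : Chains (a :: b :: k) → Chains (b :: k) × ℕ := fun m =>
      (⟨fun i => m.1 (Fin.succ i), fun i j h => m.2.1 (Fin.succ_lt_succ_iff.2 h),
        fun i => m.2.2 _⟩, m.1 (0 : Fin (k.length + 2)))
    have hinj : Function.Injective g := by
      intro m m' h
      refine Subtype.ext (funext fun i => ?_)
      refine Fin.cases ?_ (fun i => ?_) i
      · exact congrArg Prod.snd h
      · exact congrFun (congrArg Subtype.val (congrArg Prod.fst h)) i
    rw [← hinj.tsum_eq]
    · refine tsum_congr fun m => ?_
      have h1 : m.1 (Fin.succ (0 : Fin (k.length + 1))) < m.1 (0 : Fin (k.length + 2)) :=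
        m.2.1 (Fin.succ_pos _)
      have h2 : (∏ i, wt ((a :: b :: k).get i) (m.1 i)) =
          wt a (m.1 (0 : Fin (k.length + 2))) *
            ∏ i : Fin (k.length + 1), wt ((b :: k).get i) (m.1 (Fin.succ i)) :=
        Fin.prod_univ_succ (n := k.length + 1) _
      simp only [g]
      rw [if_pos h1, h2, mul_left_comm, mul_assoc]
      rfl
    · rintro ⟨m, n⟩ hn
      have hlt : m.1 (0 : Fin (k.length + 1)) < n := by
        by_contra h
        simp [h] at hn
      refine ⟨⟨Fin.cons (α := fun _ => ℕ) n m.1, ?_, ?_⟩, ?_⟩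
      · refine Fin.strictAnti_iff_succ_lt.2 fun i => ?_
        refine Fin.cases ?_ (fun i => ?_) i
        · exact hlt
        · exact m.2.1 Fin.castSucc_lt_succ
      · intro i
        refine Fin.cases ?_ (fun i => ?_) i
        · exact (Nat.zero_le _).trans_lt hlt
        · exact m.2.2 i
      · rfl

/-- Convergence is not required: for a divergent series both sides are 0 by convention. -/
theorem mzv_eq_toReal (a : ℕ) (k : List ℕ) : mzv (a :: k) = (ezeta (a :: k)).toReal := by
  have hwt : ∀ b n, wt b n ≠ ∞ := fun b n => by
    rw [wt]; split_ifs with h <;> simp [h]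
  rw [ezeta, chain_eq_tsum k a (fun _ => 1), ENNReal.tsum_toReal_eq, mzv]
  · refine tsum_congr fun m => ?_
    rw [mul_one, ENNReal.toReal_prod]
    refine Finset.prod_congr rfl fun i _ => ?_
    rw [wt, if_neg (m.2.2 i).ne']
    simp
  · intro m
    rw [mul_one]
    exact ENNReal.prod_ne_top fun i _ => hwt _ _

/-! ### The cyclic sum formula -/

/-- In `cyclicSeries_rotate` the zeta values on the left have first exponent at least 2, so the left
side is finite and bounds the rotated series. -/
theorem cyclicSeries_rotate_one (l : List ℕ) (hl : ∀ a ∈ l, 1 ≤ a) (h : cyclicSeries l ≠ ∞) :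
    cyclicSeries (l.rotate 1) ≠ ∞ := by
  cases l with
  | nil => exact h
  | cons b k =>
    obtain ⟨a, rfl⟩ := Nat.exists_eq_add_of_le' (hl b (by simp))
    rw [List.rotate_cons_succ, List.rotate_zero]
    refine ne_top_of_le_ne_top ?_ ((le_add_self).trans_eq (cyclicSeries_rotate a k).symm)
    refine ENNReal.add_ne_top.2 ⟨h, ENNReal.sum_ne_top.2 fun i hi => ?_⟩
    have hi := Finset.mem_Icc.1 hi
    refine ezeta_ne_top (by omega) _ fun c hc => ?_
    rcases List.mem_append.1 hc with hc | hc
    · exact hl c (List.mem_cons_of_mem _ hc)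
    · rw [List.mem_singleton.1 hc]; exact hi.1

/-- Direct estimation works only when the first entry exceeds 1; finiteness then spreads from that
rotation to all others. -/
theorem cyclicSeries_rotate_ne_top (k : List ℕ) (hk : ∀ a ∈ k, 1 ≤ a) (hk' : ∃ a ∈ k, 1 < a)
    (j : ℕ) : cyclicSeries (k.rotate j) ≠ ∞ := by
  obtain ⟨a, ha, ha'⟩ := hk'
  obtain ⟨u, v, rfl⟩ := List.append_of_mem ha
  have h0 : cyclicSeries (a :: v ++ u) ≠ ∞ := cyclicSeries_ne_top ha' _ fun b hb => hk b (by
    simp only [List.append_eq, List.mem_append, List.mem_cons] at hb ⊢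
    tauto)
  obtain ⟨n, hn⟩ : (a :: v ++ u) ~r (u ++ a :: v).rotate j :=
    List.isRotated_append.trans ⟨j, rfl⟩
  rw [← hn]
  clear hn
  induction n with
  | zero => rwa [List.rotate_zero]
  | succ n ih =>
    rw [← List.rotate_rotate]
    refine cyclicSeries_rotate_one _ (fun b hb => hk b ?_) ih
    have := List.mem_rotate.1 hb
    simp only [List.mem_append, List.mem_cons] at this ⊢
    tauto

theorem cyclicSumFormula (k : List ℕ) (hk : ∀ a ∈ k, 1 ≤ a) (hk' : ∃ a ∈ k, 1 < a) :
    CyclicSumFormula k := by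
  have ht : ∀ j : Fin k.length, ∀ b ∈ (k.rotate j).tail, 1 ≤ b := fun j b hb =>
    hk b (List.mem_rotate.1 (List.mem_of_mem_tail hb))
  have h1 : ∀ j : Fin k.length, 1 ≤ k.get j := fun j => hk _ (List.get_mem k j)
  have hL : ∀ j : Fin k.length, ∀ i ∈ Finset.Icc 1 (k.get j - 1),
      ezeta ((k.get j - i + 1) :: (k.rotate j).tail ++ [i]) ≠ ∞ := by
    intro j i hi
    have hi := Finset.mem_Icc.1 hi
    refine ezeta_ne_top (by omega) _ fun b hb => ?_
    rcases List.mem_append.1 hb with hb | hb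
    · exact ht j b hb
    · rw [List.mem_singleton.1 hb]; exact hi.1
  have hR : ∀ j : Fin k.length, ezeta ((k.get j + 1) :: (k.rotate j).tail) ≠ ∞ := fun j =>
    ezeta_ne_top (by have := h1 j; omega) _ (ht j)
  have hstep : ∀ j : Fin k.length, cyclicSeries (k.rotate j) +
      ∑ i ∈ Finset.Icc 1 (k.get j - 1), ezeta ((k.get j - i + 1) :: (k.rotate j).tail ++ [i]) =
        ezeta ((k.get j + 1) :: (k.rotate j).tail) + cyclicSeries (k.rotate (j + 1)) := by
    intro j
    rw [← tail_rotate_append]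
    nth_rewrite 1 [rotate_eq_cons k j]
    obtain ⟨a, ha⟩ := Nat.exists_eq_add_of_le' (h1 j)
    rw [ha]
    exact cyclicSeries_rotate a _
  have hsum := Finset.sum_congr (rfl : Finset.univ = Finset.univ) fun j _ => hstep j
  rw [Finset.sum_add_distrib, Finset.sum_add_distrib, sum_rotate_succ cyclicSeries, add_comm] at hsum
  -- Cancellation in `[0, ∞]` is valid only for a finite summand.
  have hT : ∑ j : Fin k.length, cyclicSeries (k.rotate j) ≠ ∞ :=
    ENNReal.sum_ne_top.2 fun j _ => cyclicSeries_rotate_ne_top k hk hk' j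
  have h := congrArg ENNReal.toReal ((ENNReal.add_left_inj hT).1 hsum)
  rw [ENNReal.toReal_sum fun j _ => ENNReal.sum_ne_top.2 (hL j),
    ENNReal.toReal_sum fun j _ => hR j] at h
  rw [CyclicSumFormula]
  simp only [List.cons_append, mzv_eq_toReal]
  rw [← h]
  exact Finset.sum_congr rfl fun j _ => (ENNReal.toReal_sum (hL j)).symm

end CyclicSum

open CyclicSum in
theorem mainTheorem1 :
    (∀ n : ℕ, 1 ≤ n →
      Submodule.map (rho n) H1check ≤ Submodule.map H0.val.toLinearMap (LinearMap.ker Z)) ∧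
    (∀ k : List ℕ, (∀ a ∈ k, 1 ≤ a) →
      rho 1 (zword k) =
        (∑ j : Fin k.length, ∑ i ∈ Finset.Icc 1 (k.get j - 1),
          zword ((k.get j - i + 1) :: (k.rotate j).tail ++ [i])) -
        ∑ j : Fin k.length, zword ((k.get j + 1) :: (k.rotate j).tail)) ∧
    (∀ k : List ℕ, (∀ a ∈ k, 1 ≤ a) → (∃ a ∈ k, 1 < a) →
      (∑ j : Fin k.length, ∑ i ∈ Finset.Icc 1 (k.get j - 1),
        mzv ((k.get j - i + 1) :: (k.rotate j).tail ++ [i])) =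
      ∑ j : Fin k.length, mzv ((k.get j + 1) :: (k.rotate j).tail)) := by
  refine ⟨fun n hn => ?_, rho_one_zword, cyclicSumFormula⟩
  obtain ⟨m, rfl⟩ := Nat.exists_eq_add_of_le' hn
  exact map_rho_H1check_le cyclicSumFormula m
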